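/- For $n\ge 1$ let $N_n$ be the number of connected noncrossing graphs on $n$ vertices, that is, the number of connected simple graphs on the vertex set $\{1,\dots,n\}$ such that, when the vertices are placed on a circle in this cyclic order and the edges are drawn as chords, no two edges cross; equivalently, there are no vertices $a<b<c<d$ for which both $\{a,c\}$ and $\{b,d\}$ are edges. Let $F=\sum_{m=0}^{\infty}x^{3^m}\in\mathbb{Z}[[x]]$. Then, coefficientwise, \[ \sum_{n=1}^{\infty} N_n x^n \equiv F+F^2 \pmod 3 . \] Moreover, for every $n\ge 1$, \[ N_n\equiv \begin{cases} 1 \pmod 3, & \text{if } n=3^k \text{ or } n=2\cdot 3^k \text{ for some integer } k\ge 0,\\ 2 \pmod 3, & \text{if } n=3^i+3^j \text{ for some integers } i,j\ge 0 \text{ with } i\ne j,\\ 0 \pmod 3, & \text{otherwise.} \end{cases} \] -/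

import Mathlib

/-- Place the vertices `0, 1, …, n - 1` in this cyclic order on a circle and draw edges as chords.
Two chords cross in their interiors exactly when their four endpoints are distinct and alternate
around the circle; a graph is noncrossing if no two of its edges cross. -/
def IsNoncrossing {n : ℕ} (G : SimpleGraph (Fin n)) : Prop :=
  ∀ a b c d : Fin n, a < b → b < c → c < d → ¬ (G.Adj a c ∧ G.Adj b d)

/-- The number of connected noncrossing graphs on `n` (labelled) vertices. -/
noncomputable def numConnNoncrossing (n : ℕ) : ℕ :=
  Nat.card {G : SimpleGraph (Fin n) // G.Connected ∧ IsNoncrossing G}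

/-- The generating function `∑_{n ≥ 1} N_n x ^ n`. -/
noncomputable def connNoncrossingSeries : PowerSeries ℤ :=
  PowerSeries.mk fun n => if 1 ≤ n then (numConnNoncrossing n : ℤ) else 0

open Classical in
/-- The power series `F = ∑_{m ≥ 0} x ^ (3 ^ m)`. -/
noncomputable def powThreeSeries : PowerSeries ℤ :=
  PowerSeries.mk fun n => if ∃ m : ℕ, n = 3 ^ m then 1 else 0

/-- Coefficientwise congruence of integer power series modulo `k`. -/
def PowerSeriesModEq (k : ℤ) (A B : PowerSeries ℤ) : Prop :=
  ∀ n : ℕ, PowerSeries.coeff n A ≡ PowerSeries.coeff n B [ZMOD k]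


/-!
In a connected noncrossing graph on `[l, r]` the largest neighbour `m` of `l` is a cut vertex: the
graph is the union of one on `[l, m]` containing the edge `lm` and one on `[m, r]`. Deleting the
edge `lr` from a graph that contains it leaves either a connected graph without that edge or two
connected graphs on adjacent intervals. If `C` is the generating function of all connected
noncrossing graphs and `X ^ 2 * A` that of those with the outer edge, this gives `C = X + X * A * C`
and `2 * X ^ 2 * A = C - X + C ^ 2`, hence `C ^ 3 + C ^ 2 - 3 * X * C + 2 * X ^ 2 = 0`.
Modulo `3` this is `C ^ 3 + C ^ 2 = X ^ 2`. Frobenius gives `F ^ 3 = F - X`, so `F + F ^ 2` is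
another solution, and the solution with no constant term and linear coefficient `1` is unique.
-/

open SimpleGraph PowerSeries Set
open Finset.HasAntidiagonal (antidiagonal)

section Reachability

variable {V W : Type*} {G : SimpleGraph V} {H : SimpleGraph W} {u v i : V}

theorem mem_of_reachable {s : Set V} (hs : ∀ ⦃i j⦄, G.Adj i j → i ∈ s → j ∈ s)
    (h : G.Reachable u v) (hu : u ∈ s) : v ∈ s := by
  rw [reachable_iff_reflTransGen] at h
  induction h with
  | refl => exact hu
  | tail _ hij ih => exact hs hij ih

theorem reachable_map_of_forall_adj (f : V → W)
    (hf : ∀ ⦃i j⦄, G.Adj i j → H.Reachable (f i) (f j)) (h : G.Reachable u v) :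
    H.Reachable (f u) (f v) :=
  mem_of_reachable (s := {x | H.Reachable (f u) (f x)}) (fun _ _ hij hi => hi.trans (hf hij)) h .rfl

theorem reachable_map_iff (e : V ↪ W) : (G.map e).Reachable (e u) (e v) ↔ G.Reachable u v := by
  refine ⟨fun h => ?_, fun h => h.map (Embedding.map e G).toHom⟩
  have : Nonempty V := ⟨u⟩
  have hinv := Function.leftInverse_invFun e.injective
  suffices h' : G.Reachable (Function.invFun e (e u)) (Function.invFun e (e v)) by
    rwa [hinv, hinv] at h'
  refine reachable_map_of_forall_adj _ ?_ h
  rintro _ _ ⟨-, a, b, hab, rfl, rfl⟩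
  rw [hinv, hinv]
  exact hab.reachable

theorem reachable_or_reachable_of_reachable_sup_edge (h : (G ⊔ edge u v).Reachable u i) :
    G.Reachable u i ∨ G.Reachable v i := by
  refine mem_of_reachable (s := {x | G.Reachable u x ∨ G.Reachable v x}) ?_ h (.inl .rfl)
  rintro i j (hij | hij) hi
  · exact hi.imp (·.trans hij.reachable) (·.trans hij.reachable)
  · obtain ⟨⟨rfl, rfl⟩ | ⟨rfl, rfl⟩, -⟩ := (edge_adj ..).1 hij
    exacts [.inr .rfl, .inl .rfl]

end Reachability

section Support

variable {V W : Type*} {G : SimpleGraph V} {s : Set V} {i j : V}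

theorem support_sup_edge_subset (hG : G.support ⊆ s) (hi : i ∈ s) (hj : j ∈ s) :
    (G ⊔ edge i j).support ⊆ s := by
  rintro x ⟨y, h | h⟩
  · exact hG h.left_mem_support
  · obtain ⟨⟨rfl, -⟩ | ⟨rfl, -⟩, -⟩ := (edge_adj ..).1 h <;> assumption

theorem support_subset_range_iff {e : W ↪ V} :
    G.support ⊆ range e ↔ ∃ H : SimpleGraph W, H.map e = G := by
  constructor
  · intro hG
    refine ⟨G.comap e, le_antisymm (map_comap_le e G) fun i j hij => ?_⟩
    obtain ⟨a, rfl⟩ := hG hij.left_mem_support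
    obtain ⟨b, rfl⟩ := hG hij.right_mem_support
    exact (map_adj_apply ..).2 hij
  · rintro ⟨H, rfl⟩ _ ⟨_, -, a, _, -, rfl, -⟩
    exact mem_range_self a

theorem finite_setOf_support_subset (hs : s.Finite) :
    {G : SimpleGraph V | G.support ⊆ s}.Finite := by
  have := hs.to_subtype
  refine (finite_range fun H : SimpleGraph s => H.spanningCoe).subset fun G hG => ?_
  exact ⟨G.induce s, (spanningCoe_induce_eq_self G s).2 hG⟩

/-- The subgraph formed by the edges of `G` with both ends in `s`, on the same vertex type. -/
abbrev edgesWithin (G : SimpleGraph V) (s : Set V) : SimpleGraph V := (G.induce s).spanningCoe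

theorem edgesWithin_adj : (edgesWithin G s).Adj i j ↔ G.Adj i j ∧ i ∈ s ∧ j ∈ s := by
  simp

end Support

section Cut

variable {V : Type*} [LinearOrder V] {G H : SimpleGraph V} {m m' i j : V}

/-- Every edge of `G` lies on one side of the gap between `m` and `m'`. The case `m = m'` is a cut
vertex; if `m'` is the successor of `m`, no edge joins the two sides. -/
def IsCut (G : SimpleGraph V) (m m' : V) : Prop :=
  ∀ ⦃i j⦄, G.Adj i j → (i ≤ m ∧ j ≤ m) ∨ (m' ≤ i ∧ m' ≤ j)

theorem isCut_sup (hG : G.support ⊆ Iic m) (hH : H.support ⊆ Ici m') : IsCut (G ⊔ H) m m' := by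
  rintro i j (h | h)
  · exact .inl ⟨hG h.left_mem_support, hG h.right_mem_support⟩
  · exact .inr ⟨hH h.left_mem_support, hH h.right_mem_support⟩

namespace IsCut

theorem edgesWithin_sup_edgesWithin (hG : IsCut G m m') :
    edgesWithin G (Iic m) ⊔ edgesWithin G (Ici m') = G := by
  refine le_antisymm (sup_le (G.spanningCoe_induce_le _) (G.spanningCoe_induce_le _)) ?_
  intro i j h
  exact (hG h).imp (fun hm => edgesWithin_adj.2 ⟨h, hm⟩) (fun hm => edgesWithin_adj.2 ⟨h, hm⟩)

theorem reachable_edgesWithin_Iic (hG : IsCut G m m') (hm : m ≤ m') (hi : i ≤ m) (hj : j ≤ m)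
    (h : G.Reachable i j) : (edgesWithin G (Iic m)).Reachable i j := by
  suffices h' : (edgesWithin G (Iic m)).Reachable (min i m) (min j m) by
    rwa [min_eq_left hi, min_eq_left hj] at h'
  refine reachable_map_of_forall_adj (min · m) (fun a b hab => ?_) h
  rcases hG hab with ⟨ha, hb⟩ | ⟨ha, hb⟩
  · rw [min_eq_left ha, min_eq_left hb]
    exact (edgesWithin_adj.2 ⟨hab, ha, hb⟩).reachable
  · rw [min_eq_right (hm.trans ha), min_eq_right (hm.trans hb)]

theorem reachable_edgesWithin_Ici (hG : IsCut G m m') (hm : m ≤ m') (hi : m' ≤ i) (hj : m' ≤ j)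
    (h : G.Reachable i j) : (edgesWithin G (Ici m')).Reachable i j := by
  suffices h' : (edgesWithin G (Ici m')).Reachable (max i m') (max j m') by
    rwa [max_eq_left hi, max_eq_left hj] at h'
  refine reachable_map_of_forall_adj (max · m') (fun a b hab => ?_) h
  rcases hG hab with ⟨ha, hb⟩ | ⟨ha, hb⟩
  · rw [max_eq_right (ha.trans hm), max_eq_right (hb.trans hm)]
  · rw [max_eq_left ha, max_eq_left hb]
    exact (edgesWithin_adj.2 ⟨hab, ha, hb⟩).reachable

theorem le_of_reachable (hG : IsCut G m m') (hm : m < m') (h : G.Reachable i j) (hi : i ≤ m) :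
    j ≤ m :=
  mem_of_reachable (s := Iic m)
    (fun _ _ hab ha => (hG hab).elim And.right fun h => absurd (h.1.trans ha) hm.not_ge) h hi

end IsCut

theorem edgesWithin_Iic_sup (hm : m ≤ m') (hG : G.support ⊆ Iic m) (hH : H.support ⊆ Ici m') :
    edgesWithin (G ⊔ H) (Iic m) = G := by
  ext i j
  rw [edgesWithin_adj]
  refine ⟨?_, fun h => ⟨.inl h, hG h.left_mem_support, hG h.right_mem_support⟩⟩
  rintro ⟨h | h, hi, hj⟩
  · exact h
  · have hi' : i = m := le_antisymm hi (hm.trans (hH h.left_mem_support))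
    have hj' : j = m := le_antisymm hj (hm.trans (hH h.right_mem_support))
    exact absurd (hi'.trans hj'.symm) h.ne

theorem edgesWithin_Ici_sup (hm : m ≤ m') (hG : G.support ⊆ Iic m) (hH : H.support ⊆ Ici m') :
    edgesWithin (G ⊔ H) (Ici m') = H := by
  ext i j
  rw [edgesWithin_adj]
  refine ⟨?_, fun h => ⟨.inr h, hH h.left_mem_support, hH h.right_mem_support⟩⟩
  rintro ⟨h | h, hi, hj⟩
  · have hi' : i = m' := le_antisymm ((hG h.left_mem_support).trans hm) hi
    have hj' : j = m' := le_antisymm ((hG h.right_mem_support).trans hm) hj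
    exact absurd (hi'.trans hj'.symm) h.ne
  · exact h

theorem ncard_image2_sup {A B : Set (SimpleGraph V)} (hm : m ≤ m')
    (hA : ∀ G ∈ A, G.support ⊆ Iic m) (hB : ∀ H ∈ B, H.support ⊆ Ici m') :
    (image2 (· ⊔ ·) A B).ncard = A.ncard * B.ncard := by
  rw [← image_uncurry_prod, InjOn.ncard_image, ncard_prod]
  rintro ⟨G, H⟩ ⟨hG, hH⟩ ⟨G', H'⟩ ⟨hG', hH'⟩ (h : G ⊔ H = G' ⊔ H')
  rw [Prod.mk.injEq, ← edgesWithin_Iic_sup hm (hA G hG) (hB H hH), h,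
    edgesWithin_Iic_sup hm (hA G' hG') (hB H' hH'), ← edgesWithin_Ici_sup hm (hA G hG) (hB H hH), h,
    edgesWithin_Ici_sup hm (hA G' hG') (hB H' hH')]
  exact ⟨rfl, rfl⟩

end Cut

section Noncrossing

variable {V W : Type*}

/-- The condition of `IsNoncrossing` for graphs on an arbitrary ordered vertex set, so that graphs
on different intervals of a fixed order can be compared. -/
def Noncrossing [Preorder V] (G : SimpleGraph V) : Prop :=
  ∀ a b c d : V, a < b → b < c → c < d → ¬ (G.Adj a c ∧ G.Adj b d)

theorem Noncrossing.mono [Preorder V] {G H : SimpleGraph V} (hG : Noncrossing G) (h : H ≤ G) :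
    Noncrossing H :=
  fun a b c d hab hbc hcd hH => hG a b c d hab hbc hcd ⟨h hH.1, h hH.2⟩

theorem noncrossing_map_iff [Preorder V] [Preorder W] {G : SimpleGraph V} (e : V ↪o W) :
    Noncrossing (G.map e) ↔ Noncrossing G := by
  constructor
  · intro h a b c d hab hbc hcd hG
    exact h (e a) (e b) (e c) (e d) (e.lt_iff_lt.2 hab) (e.lt_iff_lt.2 hbc) (e.lt_iff_lt.2 hcd)
      (hG.imp (map_adj_apply (f := e.toEmbedding)).2 (map_adj_apply (f := e.toEmbedding)).2)
  · rintro h _ _ _ _ hab hbc hcd ⟨⟨-, a, c, hac, rfl, rfl⟩, ⟨-, b, d, hbd, rfl, rfl⟩⟩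
    exact h a b c d (e.lt_iff_lt.1 hab) (e.lt_iff_lt.1 hbc) (e.lt_iff_lt.1 hcd) ⟨hac, hbd⟩

variable [LinearOrder V] {G H : SimpleGraph V} {l r m m' i j : V}

theorem Noncrossing.sup (hm : m ≤ m') (hG : G.support ⊆ Iic m) (hH : H.support ⊆ Ici m')
    (hGn : Noncrossing G) (hHn : Noncrossing H) : Noncrossing (G ⊔ H) := by
  rintro a b c d hab hbc hcd ⟨hac | hac, hbd | hbd⟩
  · exact hGn a b c d hab hbc hcd ⟨hac, hbd⟩
  · have hcb : c ≤ b := (hG hac.right_mem_support).trans (hm.trans (hH hbd.left_mem_support))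
    exact hbc.not_ge hcb
  · have hda : d ≤ a := (hG hbd.right_mem_support).trans (hm.trans (hH hac.left_mem_support))
    exact (hab.trans (hbc.trans hcd)).not_ge hda
  · exact hHn a b c d hab hbc hcd ⟨hac, hbd⟩

theorem Noncrossing.sup_edge (hG : G.support ⊆ Icc l r) (hGn : Noncrossing G) :
    Noncrossing (G ⊔ edge l r) := by
  rintro a b c d hab hbc hcd ⟨hac | hac, hbd | hbd⟩
  · exact hGn a b c d hab hbc hcd ⟨hac, hbd⟩
  · have := hG hac.left_mem_support
    have := hG hac.right_mem_support
    grind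
  · have := hG hbd.left_mem_support
    have := hG hbd.right_mem_support
    grind
  · grind

/-- A path from `l` to `m` must meet the edge `ij` since `l < i < m`, and by planarity it can do so
only in `i`. -/
theorem Noncrossing.reachable_of_adj (hG : Noncrossing G) (hij : G.Adj i j) (hli : l < i)
    (him : i < m) (hlt : ∀ x, G.Reachable l x → x < j) (hm : G.Reachable l m) :
    G.Reachable l i := by
  by_contra hi
  have hclosed : ∀ ⦃p q⦄, G.Adj p q → p ∈ {x | G.Reachable l x ∧ x < i} →
      q ∈ {x | G.Reachable l x ∧ x < i} := by
    rintro p q hpq ⟨hp, hpi⟩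
    have hq : G.Reachable l q := hp.trans hpq.reachable
    have hqi : q ≠ i := fun h => hi (h ▸ hq)
    exact ⟨hq, lt_of_not_ge fun hiq =>
      hG p i q j hpi (lt_of_le_of_ne hiq hqi.symm) (hlt q hq) ⟨hpq, hij⟩⟩
  exact him.not_gt (mem_of_reachable hclosed hm ⟨.rfl, hli⟩).2

end Noncrossing

section ConnNoncrossing

variable {V : Type*} [Preorder V]

/-- `G` is a connected noncrossing graph with vertex set `s`, encoded as a graph on the whole order
whose edges lie in `s`. -/
structure IsConnNoncrossingOn (s : Set V) (G : SimpleGraph V) : Prop where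
  support_subset : G.support ⊆ s
  noncrossing : Noncrossing G
  reachable : ∀ i ∈ s, ∀ j ∈ s, G.Reachable i j

/-- The set of connected noncrossing graphs with vertex set `s`. -/
def connNoncrossingOn (s : Set V) : Set (SimpleGraph V) := {G | IsConnNoncrossingOn s G}

/-- The connected noncrossing graphs on `[l, r]` that contain the outer edge `lr`. -/
def closedConnNoncrossingOn (l r : V) : Set (SimpleGraph V) :=
  {G ∈ connNoncrossingOn (Icc l r) | G.Adj l r}

/-- The noncrossing graphs on `[l, r]` which consist of two components, one containing `l` and the
other `r`. They arise by deleting the outer edge `lr` when it is a bridge. -/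
structure IsSeparatedNoncrossingOn (l r : V) (G : SimpleGraph V) : Prop where
  support_subset : G.support ⊆ Icc l r
  noncrossing : Noncrossing G
  reachable : ∀ i ∈ Icc l r, G.Reachable l i ∨ G.Reachable r i
  not_reachable : ¬ G.Reachable l r

/-- The set of graphs satisfying `IsSeparatedNoncrossingOn l r`. -/
def separatedNoncrossingOn (l r : V) : Set (SimpleGraph V) := {G | IsSeparatedNoncrossingOn l r G}

theorem finite_connNoncrossingOn {s : Set V} (hs : s.Finite) : (connNoncrossingOn s).Finite :=
  (finite_setOf_support_subset hs).subset fun _ hG => hG.support_subset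

theorem connNoncrossingOn_range {W : Type*} [Preorder W] (e : W ↪o V) :
    connNoncrossingOn (range e) =
      SimpleGraph.map e '' {G : SimpleGraph W | G.Preconnected ∧ Noncrossing G} := by
  ext G
  constructor
  · rintro ⟨hs, hn, hr⟩
    obtain ⟨G, rfl⟩ := support_subset_range_iff (e := e.toEmbedding).1 hs
    exact ⟨G, ⟨fun u v => (reachable_map_iff e.toEmbedding).1
      (hr _ (mem_range_self u) _ (mem_range_self v)), (noncrossing_map_iff e).1 hn⟩, rfl⟩
  · rintro ⟨G, ⟨hc, hn⟩, rfl⟩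
    refine ⟨support_subset_range_iff (e := e.toEmbedding).2 ⟨G, rfl⟩,
      (noncrossing_map_iff e).2 hn, ?_⟩
    rintro _ ⟨u, rfl⟩ _ ⟨v, rfl⟩
    exact (reachable_map_iff e.toEmbedding).2 (hc u v)

end ConnNoncrossing

section Decomposition

variable {V : Type*} [LinearOrder V] {G H : SimpleGraph V} {l r m m' : V}

theorem ncard_connNoncrossingOn {s : Finset V} (hs : s.Nonempty) :
    (connNoncrossingOn (s : Set V)).ncard = numConnNoncrossing s.card := by
  have : Nonempty (Fin s.card) := Fin.pos_iff_nonempty.1 hs.card_pos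
  have hinj := map_injective (s.orderEmbOfFin rfl).toEmbedding
  rw [← Finset.range_orderEmbOfFin s rfl, connNoncrossingOn_range]
  refine (ncard_image_of_injective _ hinj).trans ?_
  simp only [numConnNoncrossing, connected_iff, this, and_true]
  rfl

theorem IsCut.edgesWithin_Iic_mem_connNoncrossingOn (hG : IsCut G m m') (hm : m ≤ m')
    (hs : G.support ⊆ Icc l r) (hn : Noncrossing G)
    (hr : ∀ i ∈ Icc l m, G.Reachable l i) :
    edgesWithin G (Iic m) ∈ connNoncrossingOn (Icc l m) where
  support_subset := by
    rintro i ⟨j, h⟩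
    have h := edgesWithin_adj.1 h
    exact ⟨(hs h.1.left_mem_support).1, h.2.1⟩
  noncrossing := hn.mono (G.spanningCoe_induce_le _)
  reachable i hi j hj :=
    hG.reachable_edgesWithin_Iic hm hi.2 hj.2 ((hr i hi).symm.trans (hr j hj))

theorem IsCut.edgesWithin_Ici_mem_connNoncrossingOn (hG : IsCut G m m') (hm : m ≤ m')
    (hs : G.support ⊆ Icc l r) (hn : Noncrossing G)
    (hr : ∀ i ∈ Icc m' r, G.Reachable r i) :
    edgesWithin G (Ici m') ∈ connNoncrossingOn (Icc m' r) where
  support_subset := by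
    rintro i ⟨j, h⟩
    have h := edgesWithin_adj.1 h
    exact ⟨h.2.1, (hs h.1.left_mem_support).2⟩
  noncrossing := hn.mono (G.spanningCoe_induce_le _)
  reachable i hi j hj :=
    hG.reachable_edgesWithin_Ici hm hi.1 hj.1 ((hr i hi).symm.trans (hr j hj))

theorem sup_mem_connNoncrossingOn (hlm : l ≤ m) (hmr : m ≤ r)
    (hG : G ∈ connNoncrossingOn (Icc l m)) (hH : H ∈ connNoncrossingOn (Icc m r)) :
    G ⊔ H ∈ connNoncrossingOn (Icc l r) where
  support_subset := by
    rintro i ⟨j, h | h⟩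
    · exact Icc_subset_Icc_right hmr (hG.support_subset h.left_mem_support)
    · exact Icc_subset_Icc_left hlm (hH.support_subset h.left_mem_support)
  noncrossing := .sup le_rfl (hG.support_subset.trans Icc_subset_Iic_self)
    (hH.support_subset.trans Icc_subset_Ici_self) hG.noncrossing hH.noncrossing
  reachable := by
    have hm : ∀ i ∈ Icc l r, (G ⊔ H).Reachable m i := by
      rintro i ⟨hli, hir⟩
      rcases le_total i m with him | hmi
      · exact (hG.reachable m ⟨hlm, le_rfl⟩ i ⟨hli, him⟩).mono le_sup_left
      · exact (hH.reachable m ⟨le_rfl, hmr⟩ i ⟨hmi, hir⟩).mono le_sup_right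
    exact fun i hi j hj => (hm i hi).symm.trans (hm j hj)

theorem isGreatest_neighborSet_sup (hlm : l < m) (hG : G ∈ closedConnNoncrossingOn l m)
    (hH : H.support ⊆ Ici m) : IsGreatest ((G ⊔ H).neighborSet l) m := by
  refine ⟨.inl hG.2, ?_⟩
  rintro i (h | h)
  · exact (hG.1.support_subset h.right_mem_support).2
  · exact absurd (hH h.left_mem_support) hlm.not_ge

theorem isCut_of_isGreatest_neighborSet (hs : G.support ⊆ Icc l r) (hn : Noncrossing G)
    (hm : IsGreatest (G.neighborSet l) m) : IsCut G m m := by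
  have hstraddle : ∀ ⦃i j⦄, G.Adj i j → i < m → j ≤ m := by
    intro i j hij him
    rcases (hs hij.left_mem_support).1.eq_or_lt with rfl | hli
    · exact hm.2 hij
    · exact le_of_not_gt fun hmj => hn l i m j hli him hmj ⟨hm.1, hij⟩
  intro i j hij
  have := hstraddle hij
  have := hstraddle hij.symm
  grind

theorem IsConnNoncrossingOn.exists_isGreatest_neighborSet [LocallyFiniteOrder V]
    (hG : IsConnNoncrossingOn (Icc l r) G) (hlr : l < r) :
    ∃ m, IsGreatest (G.neighborSet l) m := by
  have hr : G.Reachable l r := hG.reachable l ⟨le_rfl, hlr.le⟩ r ⟨hlr.le, le_rfl⟩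
  have hne : (G.neighborSet l).Nonempty := mem_support_of_reachable hlr.ne hr
  have hsub : G.neighborSet l ⊆ Icc l r := (G.neighborSet_subset_support l).trans hG.support_subset
  simpa only [maximal_iff_isGreatest] using ((finite_Icc l r).subset hsub).exists_maximal hne

theorem connNoncrossingOn_Icc_eq_biUnion [LocallyFiniteOrder V] (hlr : l < r) :
    connNoncrossingOn (Icc l r) = ⋃ m ∈ Finset.Ioc l r,
      image2 (· ⊔ ·) (closedConnNoncrossingOn l m) (connNoncrossingOn (Icc m r)) := by
  ext G
  simp only [mem_iUnion₂, Finset.mem_Ioc, mem_image2, exists_prop]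
  constructor
  · intro hG
    obtain ⟨m, hm⟩ := hG.exists_isGreatest_neighborSet hlr
    have hlm : l < m := (hG.support_subset hm.1.right_mem_support).1.lt_of_ne hm.1.ne
    have hmr : m ≤ r := (hG.support_subset hm.1.right_mem_support).2
    have hcut := isCut_of_isGreatest_neighborSet hG.support_subset hG.noncrossing hm
    refine ⟨m, ⟨hlm, hmr⟩, edgesWithin G (Iic m), ⟨?_, ?_⟩, edgesWithin G (Ici m), ?_,
      hcut.edgesWithin_sup_edgesWithin⟩
    · exact hcut.edgesWithin_Iic_mem_connNoncrossingOn le_rfl hG.support_subset hG.noncrossing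
        fun i hi => hG.reachable l ⟨le_rfl, hlr.le⟩ i (Icc_subset_Icc_right hmr hi)
    · exact edgesWithin_adj.2 ⟨hm.1, hlm.le, le_rfl⟩
    · exact hcut.edgesWithin_Ici_mem_connNoncrossingOn le_rfl hG.support_subset hG.noncrossing
        fun i hi => hG.reachable r ⟨hlr.le, le_rfl⟩ i (Icc_subset_Icc_left hlm.le hi)
  · rintro ⟨m, ⟨hlm, hmr⟩, A, hA, B, hB, rfl⟩
    exact sup_mem_connNoncrossingOn hlm.le hmr hA.1 hB

theorem sup_mem_separatedNoncrossingOn (hlm : l ≤ m) (hm : m ⋖ m') (hmr : m' ≤ r)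
    (hG : G ∈ connNoncrossingOn (Icc l m)) (hH : H ∈ connNoncrossingOn (Icc m' r)) :
    G ⊔ H ∈ separatedNoncrossingOn l r := by
  have hGs : G.support ⊆ Iic m := hG.support_subset.trans Icc_subset_Iic_self
  have hHs : H.support ⊆ Ici m' := hH.support_subset.trans Icc_subset_Ici_self
  refine ⟨?_, .sup hm.le hGs hHs hG.noncrossing hH.noncrossing, ?_, fun h => ?_⟩
  · rintro i ⟨j, h | h⟩
    · exact Icc_subset_Icc_right (hm.le.trans hmr) (hG.support_subset h.left_mem_support)
    · exact Icc_subset_Icc_left (hlm.trans hm.le) (hH.support_subset h.left_mem_support)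
  · rintro i ⟨hli, hir⟩
    rcases le_or_gt i m with him | hmi
    · exact .inl ((hG.reachable l ⟨le_rfl, hlm⟩ i ⟨hli, him⟩).mono le_sup_left)
    · exact .inr ((hH.reachable r ⟨hmr, le_rfl⟩ i ⟨hm.ge_of_gt hmi, hir⟩).mono le_sup_right)
  · exact (hm.lt.trans_le hmr).not_ge ((isCut_sup hGs hHs).le_of_reachable hm.lt h hlm)

theorem isGreatest_reachable_sup (hlm : l ≤ m) (hm : m < m')
    (hG : G ∈ connNoncrossingOn (Icc l m)) (hH : H.support ⊆ Ici m') :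
    IsGreatest {i | (G ⊔ H).Reachable l i} m :=
  ⟨(hG.reachable l ⟨le_rfl, hlm⟩ m ⟨hlm, le_rfl⟩).mono le_sup_left, fun _ hi =>
    (isCut_sup (hG.support_subset.trans Icc_subset_Iic_self) hH).le_of_reachable hm hi hlm⟩

theorem isCut_of_isGreatest_reachable (hs : G.support ⊆ Icc l r) (hn : Noncrossing G)
    (hm : m ⋖ m') (hgr : IsGreatest {i | G.Reachable l i} m) : IsCut G m m' := by
  have hstraddle : ∀ ⦃i j⦄, G.Adj i j → i ≤ m → j ≤ m := by
    intro i j hij him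
    by_contra! hmj
    have hi : ¬ G.Reachable l i := fun h => hmj.not_ge (hgr.2 (h.trans hij.reachable))
    have hli : l < i := (hs hij.left_mem_support).1.lt_of_ne fun h => hi (h ▸ .rfl)
    have him : i < m := him.lt_of_ne fun h => hi (h ▸ hgr.1)
    exact hi (hn.reachable_of_adj hij hli him (fun x hx => (hgr.2 hx).trans_lt hmj) hgr.1)
  intro i j hij
  rcases le_or_gt i m with hi | hi
  · exact .inl ⟨hi, hstraddle hij hi⟩
  · have hj : m < j := lt_of_not_ge fun hj => hi.not_ge (hstraddle hij.symm hj)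
    exact .inr ⟨hm.ge_of_gt hi, hm.ge_of_gt hj⟩

theorem IsSeparatedNoncrossingOn.exists_isGreatest_reachable [LocallyFiniteOrder V]
    (hG : IsSeparatedNoncrossingOn l r G) (hlr : l ≤ r) :
    ∃ m ∈ Ico l r, IsGreatest {i | G.Reachable l i} m := by
  have hsub : {i | G.Reachable l i} ⊆ Icc l r := fun i hi =>
    mem_of_reachable (fun _ _ hab _ => hG.support_subset hab.right_mem_support) hi ⟨le_rfl, hlr⟩
  obtain ⟨m, hm⟩ := ((finite_Icc l r).subset hsub).exists_maximal ⟨l, .rfl⟩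
  rw [maximal_iff_isGreatest] at hm
  exact ⟨m, ⟨(hsub hm.1).1, (hsub hm.1).2.lt_of_ne fun h => hG.not_reachable (h ▸ hm.1)⟩, hm⟩

theorem separatedNoncrossingOn_eq_biUnion [LocallyFiniteOrder V] [SuccOrder V] (hlr : l ≤ r) :
    separatedNoncrossingOn l r = ⋃ m ∈ Finset.Ico l r,
      image2 (· ⊔ ·) (connNoncrossingOn (Icc l m)) (connNoncrossingOn (Icc (Order.succ m) r)) := by
  ext G
  simp only [mem_iUnion₂, Finset.mem_Ico, mem_image2, exists_prop]
  constructor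
  · intro hG
    obtain ⟨m, ⟨hlm, hmr⟩, hgr⟩ := hG.exists_isGreatest_reachable hlr
    have hm : m ⋖ Order.succ m := Order.covBy_succ_of_not_isMax (not_isMax_of_lt hmr)
    have hcut := isCut_of_isGreatest_reachable hG.support_subset hG.noncrossing hm hgr
    refine ⟨m, ⟨hlm, hmr⟩, edgesWithin G (Iic m), ?_, edgesWithin G (Ici (Order.succ m)), ?_,
      hcut.edgesWithin_sup_edgesWithin⟩
    · refine hcut.edgesWithin_Iic_mem_connNoncrossingOn hm.le hG.support_subset hG.noncrossing
        fun i hi => (hG.reachable i (Icc_subset_Icc_right hmr.le hi)).resolve_right fun h => ?_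
      exact hmr.not_ge (hcut.le_of_reachable hm.lt h.symm hi.2)
    · refine hcut.edgesWithin_Ici_mem_connNoncrossingOn hm.le hG.support_subset hG.noncrossing
        fun i hi => (hG.reachable i (Icc_subset_Icc_left (hlm.trans hm.le) hi)).resolve_left ?_
      exact fun h => (hm.lt.trans_le hi.1).not_ge (hgr.2 h)
  · rintro ⟨m, ⟨hlm, hmr⟩, A, hA, B, hB, rfl⟩
    exact sup_mem_separatedNoncrossingOn hlm
      (Order.covBy_succ_of_not_isMax (not_isMax_of_lt hmr)) (Order.succ_le_of_lt hmr) hA hB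

theorem sup_edge_mem_closedConnNoncrossingOn (hlr : l < r) (hs : G.support ⊆ Icc l r)
    (hn : Noncrossing G) (hr : ∀ i ∈ Icc l r, G.Reachable l i ∨ G.Reachable r i) :
    G ⊔ edge l r ∈ closedConnNoncrossingOn l r := by
  have hadj : (G ⊔ edge l r).Adj l r := .inr ((edge_adj ..).2 ⟨.inl ⟨rfl, rfl⟩, hlr.ne⟩)
  have hl : ∀ i ∈ Icc l r, (G ⊔ edge l r).Reachable l i := fun i hi =>
    (hr i hi).elim (·.mono le_sup_left) (hadj.reachable.trans <| ·.mono le_sup_left)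
  exact ⟨⟨support_sup_edge_subset hs ⟨le_rfl, hlr.le⟩ ⟨hlr.le, le_rfl⟩, hn.sup_edge hs,
    fun i hi j hj => (hl i hi).symm.trans (hl j hj)⟩, hadj⟩

theorem image_sup_edge (hlr : l < r) :
    (· ⊔ edge l r) '' ((connNoncrossingOn (Icc l r) \ closedConnNoncrossingOn l r) ∪
      separatedNoncrossingOn l r) = closedConnNoncrossingOn l r := by
  refine Subset.antisymm ?_ fun G hG => ?_
  · rintro _ ⟨G, ⟨hG, -⟩ | hG, rfl⟩
    · exact sup_edge_mem_closedConnNoncrossingOn hlr hG.support_subset hG.noncrossing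
        fun i hi => .inl (hG.reachable l ⟨le_rfl, hlr.le⟩ i hi)
    · exact sup_edge_mem_closedConnNoncrossingOn hlr hG.support_subset hG.noncrossing hG.reachable
  · set H := G \ edge l r with hH
    have hHG : H ⊔ edge l r = G := by rw [hH, sdiff_sup_cancel ((edge_le_iff G).2 (.inr hG.2))]
    have hs : H.support ⊆ Icc l r := (support_mono sdiff_le).trans hG.1.support_subset
    have hn : Noncrossing H := hG.1.noncrossing.mono sdiff_le
    have hreach : ∀ i ∈ Icc l r, H.Reachable l i ∨ H.Reachable r i := fun i hi =>
      reachable_or_reachable_of_reachable_sup_edge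
        (hHG ▸ hG.1.reachable l ⟨le_rfl, hlr.le⟩ i hi)
    have hadj : ¬ H.Adj l r := fun h => h.2 ((edge_adj ..).2 ⟨.inl ⟨rfl, rfl⟩, hlr.ne⟩)
    refine ⟨H, ?_, hHG⟩
    by_cases hlr' : H.Reachable l r
    · have hl : ∀ i ∈ Icc l r, H.Reachable l i := fun i hi => (hreach i hi).elim id hlr'.trans
      exact .inl ⟨⟨hs, hn, fun i hi j hj => (hl i hi).symm.trans (hl j hj)⟩, fun h => hadj h.2⟩
    · exact .inr ⟨hs, hn, hreach, hlr'⟩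

end Decomposition

section Counting

theorem ncard_eq_sum_of_isGreatest {α ι : Type*} [PartialOrder ι] {S : Set α} (hS : S.Finite)
    {I : Finset ι} {T : ι → Set α} (hST : S = ⋃ i ∈ I, T i) (key : α → Set ι)
    (hkey : ∀ i ∈ I, ∀ x ∈ T i, IsGreatest (key x) i) : S.ncard = ∑ i ∈ I, (T i).ncard := by
  have hfin : ∀ i ∈ I, (T i).Finite := fun i hi => hS.subset (hST ▸ subset_biUnion_of_mem hi)
  have hdisj : (I : Set ι).PairwiseDisjoint T := fun i hi j hj hij =>
    disjoint_left.2 fun x hxi hxj => hij ((hkey i hi x hxi).unique (hkey j hj x hxj))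
  rw [hST, ← finsum_mem_coe_finset]
  exact I.finite_toSet.ncard_biUnion hfin hdisj

variable {V : Type*} [LinearOrder V] [LocallyFiniteOrder V] {l r : V}

theorem ncard_connNoncrossingOn_Icc (hlr : l < r) :
    (connNoncrossingOn (Icc l r)).ncard = ∑ m ∈ Finset.Ioc l r,
      (closedConnNoncrossingOn l m).ncard * (connNoncrossingOn (Icc m r)).ncard := by
  have hright : ∀ m, ∀ H ∈ connNoncrossingOn (Icc m r), H.support ⊆ Ici m :=
    fun m H hH => hH.support_subset.trans Icc_subset_Ici_self
  rw [ncard_eq_sum_of_isGreatest (finite_connNoncrossingOn (finite_Icc l r))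
    (connNoncrossingOn_Icc_eq_biUnion hlr) (neighborSet · l)]
  · exact Finset.sum_congr rfl fun m _ => ncard_image2_sup le_rfl
      (fun G hG => hG.1.support_subset.trans Icc_subset_Iic_self) (hright m)
  · rintro m hm _ ⟨G, hG, H, hH, rfl⟩
    exact isGreatest_neighborSet_sup (Finset.mem_Ioc.1 hm).1 hG (hright m H hH)

theorem finite_separatedNoncrossingOn (l r : V) : (separatedNoncrossingOn l r).Finite :=
  (finite_setOf_support_subset (finite_Icc l r)).subset fun _ hG => hG.support_subset

theorem ncard_separatedNoncrossingOn [SuccOrder V] (hlr : l ≤ r) :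
    (separatedNoncrossingOn l r).ncard = ∑ m ∈ Finset.Ico l r,
      (connNoncrossingOn (Icc l m)).ncard *
        (connNoncrossingOn (Icc (Order.succ m) r)).ncard := by
  have hright : ∀ m, ∀ H ∈ connNoncrossingOn (Icc (Order.succ m) r),
      H.support ⊆ Ici (Order.succ m) := fun m H hH => hH.support_subset.trans Icc_subset_Ici_self
  rw [ncard_eq_sum_of_isGreatest (finite_separatedNoncrossingOn l r)
    (separatedNoncrossingOn_eq_biUnion hlr) fun G => {i | G.Reachable l i}]
  · exact Finset.sum_congr rfl fun m _ => ncard_image2_sup (Order.le_succ m)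
      (fun G hG => hG.support_subset.trans Icc_subset_Iic_self) (hright m)
  · rintro m hm _ ⟨G, hG, H, hH, rfl⟩
    obtain ⟨hlm, hmr⟩ := Finset.mem_Ico.1 hm
    exact isGreatest_reachable_sup hlm (Order.lt_succ_of_not_isMax (not_isMax_of_lt hmr)) hG
      (hright m H hH)

theorem injOn_sup_edge {W : Type*} (u v : W) :
    InjOn (· ⊔ edge u v) {G : SimpleGraph W | ¬ G.Adj u v} := by
  intro G hG H hH (h : G ⊔ edge u v = H ⊔ edge u v)
  rw [← sdiff_edge _ hG, ← sup_sdiff_right_self, h, sup_sdiff_right_self, sdiff_edge _ hH]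

theorem two_mul_ncard_closedConnNoncrossingOn (hlr : l < r) :
    2 * (closedConnNoncrossingOn l r).ncard =
      (connNoncrossingOn (Icc l r)).ncard + (separatedNoncrossingOn l r).ncard := by
  have hfin : (connNoncrossingOn (Icc l r)).Finite := finite_connNoncrossingOn (finite_Icc l r)
  have hdisj : Disjoint (connNoncrossingOn (Icc l r) \ closedConnNoncrossingOn l r)
      (separatedNoncrossingOn l r) := disjoint_left.2 fun G hG hG' =>
    hG'.not_reachable (hG.1.reachable l ⟨le_rfl, hlr.le⟩ r ⟨hlr.le, le_rfl⟩)
  have hadj : (connNoncrossingOn (Icc l r) \ closedConnNoncrossingOn l r) ∪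
      separatedNoncrossingOn l r ⊆ {G | ¬ G.Adj l r} := by
    rintro G (hG | hG) h
    · exact hG.2 ⟨hG.1, h⟩
    · exact hG.not_reachable h.reachable
  have hdelete := congrArg ncard (image_sup_edge hlr)
  rw [((injOn_sup_edge l r).mono hadj).ncard_image,
    ncard_union_eq hdisj hfin.sdiff (finite_separatedNoncrossingOn l r)] at hdelete
  have hsplit := ncard_sdiff_add_ncard_of_subset
    (show closedConnNoncrossingOn l r ⊆ connNoncrossingOn (Icc l r) from sep_subset _ _) hfin
  omega

theorem ncard_connNoncrossingOn_Icc_nat {l r : ℕ} (hlr : l ≤ r) :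
    (connNoncrossingOn (Icc l r)).ncard = numConnNoncrossing (r - l + 1) := by
  rw [← Finset.coe_Icc, ncard_connNoncrossingOn (Finset.nonempty_Icc.2 hlr), Nat.card_Icc,
    Nat.sub_add_comm hlr]

/-- The number of connected noncrossing graphs on the `n + 2` vertices `0, …, n + 1` that contain
the outer edge joining `0` and `n + 1`. -/
noncomputable def numClosedConnNoncrossing (n : ℕ) : ℕ :=
  (closedConnNoncrossingOn 0 (n + 1)).ncard

theorem numConnNoncrossing_add_two (n : ℕ) :
    numConnNoncrossing (n + 2) = ∑ p ∈ antidiagonal n,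
      numClosedConnNoncrossing p.1 * numConnNoncrossing (p.2 + 1) := by
  have h := ncard_connNoncrossingOn_Icc n.succ_pos
  rw [ncard_connNoncrossingOn_Icc_nat n.succ.zero_le] at h
  refine h.trans ?_
  rw [Finset.Nat.sum_antidiagonal_eq_sum_range_succ_mk, ← Finset.Ico_add_one_add_one_eq_Ioc,
    ← Finset.sum_Ico_add', ← Finset.range_eq_Ico]
  refine Finset.sum_congr rfl fun m hm => congrArg (numClosedConnNoncrossing m * ·) ?_
  refine (ncard_connNoncrossingOn_Icc_nat (Finset.mem_range.1 hm)).trans ?_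
  rw [Nat.succ_sub_succ]

theorem two_mul_numClosedConnNoncrossing (n : ℕ) :
    2 * numClosedConnNoncrossing n = numConnNoncrossing (n + 2) +
      ∑ p ∈ antidiagonal n,
        numConnNoncrossing (p.1 + 1) * numConnNoncrossing (p.2 + 1) := by
  rw [numClosedConnNoncrossing, two_mul_ncard_closedConnNoncrossingOn n.succ_pos,
    ncard_separatedNoncrossingOn n.succ.zero_le, ncard_connNoncrossingOn_Icc_nat n.succ.zero_le,
    Finset.Nat.sum_antidiagonal_eq_sum_range_succ_mk, ← Finset.range_eq_Ico]
  congr 1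
  refine Finset.sum_congr rfl fun m hm => congrArg₂ (· * ·) ?_ ?_
  · exact ncard_connNoncrossingOn_Icc_nat m.zero_le
  · refine (ncard_connNoncrossingOn_Icc_nat (Finset.mem_range.1 hm)).trans ?_
    rw [Nat.succ_sub_succ]

end Counting

section GeneratingFunctions

/-- The generating function `∑ a_n x ^ n` of `a_n = numClosedConnNoncrossing n`. As `a_n` counts
graphs on `n + 2` vertices, it is `X ^ 2 * closedConnNoncrossingSeries` which is indexed by the
number of vertices. -/
noncomputable def closedConnNoncrossingSeries : ℤ⟦X⟧ :=
  mk fun n => (numClosedConnNoncrossing n : ℤ)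

theorem numConnNoncrossing_one : numConnNoncrossing 1 = 1 := by
  rw [numConnNoncrossing, Nat.card_eq_one_iff_unique]
  exact ⟨⟨fun a b => Subtype.ext (Subsingleton.elim _ _)⟩,
    ⟨⊥, .of_subsingleton, fun a b c d h => by omega⟩⟩

theorem connNoncrossingSeries_eq_X_mul :
    connNoncrossingSeries = X * mk fun n => (numConnNoncrossing (n + 1) : ℤ) := by
  ext (_ | n)
  · simp [connNoncrossingSeries]
  · simp [connNoncrossingSeries, coeff_succ_X_mul]

theorem connNoncrossingSeries_eq :
    connNoncrossingSeries =
      X + X * closedConnNoncrossingSeries * connNoncrossingSeries := by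
  suffices h : (mk fun n => (numConnNoncrossing (n + 1) : ℤ)) =
      1 + X * (closedConnNoncrossingSeries * mk fun n => (numConnNoncrossing (n + 1) : ℤ)) by
    rw [connNoncrossingSeries_eq_X_mul]
    linear_combination X * h
  ext (_ | n)
  · simp [numConnNoncrossing_one]
  · rw [map_add, coeff_succ_X_mul, coeff_mul, coeff_mk, numConnNoncrossing_add_two]
    simp [closedConnNoncrossingSeries, coeff_one]

theorem two_mul_X_sq_mul_closedConnNoncrossingSeries :
    2 * X ^ 2 * closedConnNoncrossingSeries =
      connNoncrossingSeries - X + connNoncrossingSeries ^ 2 := by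
  set D : ℤ⟦X⟧ := mk fun n => (numConnNoncrossing (n + 1) : ℤ) with hD
  suffices h : D = 1 + X * (2 * closedConnNoncrossingSeries - D * D) by
    rw [connNoncrossingSeries_eq_X_mul]
    linear_combination -X * h
  ext (_ | n)
  · simp [hD, numConnNoncrossing_one]
  · have h : 2 * (numClosedConnNoncrossing n : ℤ) = numConnNoncrossing (n + 2) +
        ∑ p ∈ antidiagonal n,
          (numConnNoncrossing (p.1 + 1) * numConnNoncrossing (p.2 + 1) : ℤ) := by
      exact_mod_cast two_mul_numClosedConnNoncrossing n
    rw [map_add, coeff_succ_X_mul, two_mul, map_sub, map_add, coeff_mul]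
    simp only [hD, closedConnNoncrossingSeries, coeff_mk, coeff_one, n.succ_ne_zero, if_false]
    rw [← two_mul, h, zero_add, add_sub_cancel_right]

theorem connNoncrossingSeries_cubic :
    connNoncrossingSeries ^ 3 + connNoncrossingSeries ^ 2 - 3 * X * connNoncrossingSeries
      + 2 * X ^ 2 = 0 := by
  linear_combination -(2 * X) * connNoncrossingSeries_eq -
    connNoncrossingSeries * two_mul_X_sq_mul_closedConnNoncrossingSeries

end GeneratingFunctions

section PowSeries

variable {b : ℕ} {R : Type*}

theorem eq_of_pow_add_pow_eq_of_le {i j k l : ℕ} (hb : 2 ≤ b) (hij : i ≤ j) (hkl : k ≤ l)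
    (h : b ^ i + b ^ j = b ^ k + b ^ l) : i = k ∧ j = l := by
  have hle : ∀ {i j k l : ℕ}, i ≤ j → b ^ i + b ^ j = b ^ k + b ^ l → l ≤ j := by
    intro i j k l hij h
    refine Nat.lt_succ_iff.1 ((Nat.pow_lt_pow_iff_right hb).1 ?_)
    calc b ^ l < b ^ k + b ^ l := Nat.lt_add_of_pos_left (by positivity)
      _ = b ^ i + b ^ j := h.symm
      _ ≤ 2 * b ^ j := by rw [two_mul]; gcongr; omega
      _ ≤ b ^ (j + 1) := by rw [pow_succ']; gcongr
  obtain rfl : j = l := le_antisymm (hle hkl h.symm) (hle hij h)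
  exact ⟨Nat.pow_right_injective hb (Nat.add_right_cancel h), rfl⟩

theorem pow_add_pow_eq_iff {i j k l : ℕ} (hb : 2 ≤ b) :
    b ^ i + b ^ j = b ^ k + b ^ l ↔ i = k ∧ j = l ∨ i = l ∧ j = k := by
  refine ⟨fun h => ?_, ?_⟩
  · wlog hij : i ≤ j generalizing i j
    · exact (this (by omega) (by omega)).symm.imp And.symm And.symm
    rcases le_total k l with hkl | hlk
    · exact .inl (eq_of_pow_add_pow_eq_of_le hb hij hkl h)
    · exact .inr (eq_of_pow_add_pow_eq_of_le hb hij hlk (h.trans (add_comm _ _)))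
  · rintro (⟨rfl, rfl⟩ | ⟨rfl, rfl⟩)
    exacts [rfl, add_comm _ _]

open Classical in
/-- The power series `∑ x ^ (b ^ m)` over `R`, of which `powThreeSeries` is the case `b = 3`,
`R = ℤ`. Each exponent counts once, also for `b ≤ 1`. -/
noncomputable def powSeries (b : ℕ) (R : Type*) [Semiring R] : R⟦X⟧ :=
  mk fun n => if ∃ m : ℕ, n = b ^ m then 1 else 0

section Semiring

variable [Semiring R] {n : ℕ}

theorem coeff_powSeries_pow (k : ℕ) : coeff (b ^ k) (powSeries b R) = 1 := by
  rw [powSeries, coeff_mk, if_pos ⟨k, rfl⟩]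

theorem coeff_powSeries_of_ne (h : ∀ k, n ≠ b ^ k) : coeff n (powSeries b R) = 0 := by
  rw [powSeries, coeff_mk, if_neg (not_exists.2 h)]

theorem map_powSeries {S : Type*} [Semiring S] (f : R →+* S) :
    map f (powSeries b R) = powSeries b S := by
  ext n
  simp only [powSeries, coeff_map, coeff_mk, apply_ite f, map_one, map_zero]

theorem constantCoeff_powSeries (hb : b ≠ 0) : constantCoeff (powSeries b R) = 0 :=
  (coeff_zero_eq_constantCoeff_apply _).symm.trans
    (coeff_powSeries_of_ne fun k => (pow_ne_zero k hb).symm)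

theorem coeff_one_powSeries : coeff 1 (powSeries b R) = 1 :=
  pow_zero b ▸ coeff_powSeries_pow 0

theorem coeff_powSeries_sq_of_ne (h : ∀ i j, n ≠ b ^ i + b ^ j) :
    coeff n (powSeries b R ^ 2) = 0 := by
  rw [sq, coeff_mul]
  refine Finset.sum_eq_zero fun p hp => ?_
  have hp : p.1 + p.2 = n := Finset.HasAntidiagonal.mem_antidiagonal.1 hp
  by_cases hi : ∃ i, p.1 = b ^ i
  · obtain ⟨i, hi⟩ := hi
    rw [coeff_powSeries_of_ne (n := p.2) fun j hj => h i j (by rw [← hp, hi, hj]), mul_zero]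
  · rw [coeff_powSeries_of_ne (not_exists.1 hi), zero_mul]

theorem coeff_powSeries_sq_add (hb : 2 ≤ b) (i j : ℕ) :
    coeff (b ^ i + b ^ j) (powSeries b R ^ 2) = if i = j then 1 else 2 := by
  have hsub : {(b ^ i, b ^ j), (b ^ j, b ^ i)} ⊆ antidiagonal (b ^ i + b ^ j) := by
    simp [Finset.insert_subset_iff, add_comm]
  rw [sq, coeff_mul, ← Finset.sum_subset hsub]
  · split_ifs with hij
    · simp [hij, coeff_powSeries_pow]
    · rw [Finset.sum_pair fun h => hij (Nat.pow_right_injective hb (congrArg Prod.fst h))]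
      simp only [coeff_powSeries_pow, mul_one, one_add_one_eq_two]
  · rintro ⟨p, q⟩ hpq hne
    by_contra h0
    obtain ⟨k, rfl⟩ : ∃ k, p = b ^ k :=
      not_forall_not.1 fun h => h0 (by rw [coeff_powSeries_of_ne h, zero_mul])
    obtain ⟨l, rfl⟩ : ∃ l, q = b ^ l :=
      not_forall_not.1 fun h => h0 (by rw [coeff_powSeries_of_ne h, mul_zero])
    rcases (pow_add_pow_eq_iff hb).1 (Finset.HasAntidiagonal.mem_antidiagonal.1 hpq) with
      ⟨rfl, rfl⟩ | ⟨rfl, rfl⟩ <;> simp at hne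

end Semiring

theorem expand_powSeries [CommRing R] (hb : 2 ≤ b) :
    expand b (by omega) (powSeries b R) = powSeries b R - X := by
  ext n
  rw [map_sub, coeff_X]
  by_cases hn : b ∣ n
  · obtain ⟨n, rfl⟩ := hn
    have h1 : b * n ≠ 1 := fun h => by have := Nat.eq_one_of_mul_eq_one_right h; omega
    rw [coeff_expand_mul, if_neg h1, sub_zero]
    by_cases hk : ∃ k, n = b ^ k
    · obtain ⟨k, rfl⟩ := hk
      rw [← pow_succ', coeff_powSeries_pow, coeff_powSeries_pow]
    · refine (coeff_powSeries_of_ne (not_exists.1 hk)).trans (coeff_powSeries_of_ne ?_).symm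
      rintro (_ | k) h
      · exact h1 h
      · exact hk ⟨k, Nat.eq_of_mul_eq_mul_left (by omega) (h.trans (pow_succ' b k))⟩
  · rw [coeff_expand_of_not_dvd _ _ _ hn]
    split_ifs with h1
    · rw [h1, coeff_one_powSeries, sub_self]
    · rw [coeff_powSeries_of_ne, sub_zero]
      rintro (_ | k) rfl
      exacts [h1 (pow_zero b), hn (dvd_pow_self b k.succ_ne_zero)]

theorem powSeries_pow_char [CommRing R] (p : ℕ) [hp : Fact p.Prime] [CharP R p] :
    powSeries p R ^ p = powSeries p R - X := by
  rw [← expand_powSeries hp.out.two_le]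
  have h := MvPowerSeries.map_frobenius_expand p hp.out.ne_zero (f := powSeries p R)
  exact h.symm.trans ((map_expand _ _ _ _).trans (by rw [map_powSeries]))

end PowSeries

theorem eq_of_cube_add_sq_eq {R : Type*} [CommRing R] [IsDomain R] {f g : R⟦X⟧}
    (hf : constantCoeff f = 0) (hg : constantCoeff g = 0) (hfg : coeff 1 f + coeff 1 g ≠ 0)
    (h : f ^ 3 + f ^ 2 = g ^ 3 + g ^ 2) : f = g := by
  have hfactor : (f - g) * (f ^ 2 + f * g + g ^ 2 + f + g) = 0 := by linear_combination h
  refine sub_eq_zero.1 ((mul_eq_zero.1 hfactor).resolve_right fun h0 => hfg ?_)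
  simpa [sq, coeff_one_mul, hf, hg] using congrArg (coeff 1) h0

section ModThree

theorem three_eq_zero_powerSeries_zmod_three : (3 : (ZMod 3)⟦X⟧) = 0 :=
  (map_ofNat (C (R := ZMod 3)) 3).symm.trans (map_zero C)

theorem powerSeriesModEq_iff_map_eq {k : ℕ} {A B : ℤ⟦X⟧} :
    PowerSeriesModEq k A B ↔
      map (Int.castRingHom (ZMod k)) A = map (Int.castRingHom (ZMod k)) B := by
  simp only [PowerSeriesModEq, PowerSeries.ext_iff, coeff_map, eq_intCast,
    ZMod.intCast_eq_intCast_iff]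

theorem map_connNoncrossingSeries_cubic :
    map (Int.castRingHom (ZMod 3)) connNoncrossingSeries ^ 3 +
      map (Int.castRingHom (ZMod 3)) connNoncrossingSeries ^ 2 = X ^ 2 := by
  have h := congrArg (map (Int.castRingHom (ZMod 3))) connNoncrossingSeries_cubic
  simp only [map_add, map_sub, map_mul, map_pow, map_ofNat, map_X, map_zero] at h
  linear_combination h +
    (X * map (Int.castRingHom (ZMod 3)) connNoncrossingSeries - X ^ 2) *
      three_eq_zero_powerSeries_zmod_three

theorem connNoncrossingSeries_modEq :
    PowerSeriesModEq 3 connNoncrossingSeries (powThreeSeries + powThreeSeries ^ 2) := by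
  refine powerSeriesModEq_iff_map_eq (k := 3).2 ?_
  rw [map_add, map_pow, show powThreeSeries = powSeries 3 ℤ from rfl, map_powSeries]
  set c := map (Int.castRingHom (ZMod 3)) connNoncrossingSeries with hc
  set f := powSeries 3 (ZMod 3)
  have hc0 : constantCoeff c = 0 := by
    simp [hc, ← coeff_zero_eq_constantCoeff_apply, connNoncrossingSeries]
  have hc1 : coeff 1 c = 1 := by simp [hc, connNoncrossingSeries, numConnNoncrossing_one]
  have hf0 : constantCoeff f = 0 := constantCoeff_powSeries three_ne_zero
  have hf1 : coeff 1 f = 1 := coeff_one_powSeries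
  have hroot : (f + f ^ 2) ^ 3 + (f + f ^ 2) ^ 2 = X ^ 2 := by
    have hX : X = f - f ^ 3 := (sub_sub_cancel f X).symm.trans (by rw [powSeries_pow_char])
    rw [hX]
    linear_combination f ^ 3 * (f + 1) ^ 2 * three_eq_zero_powerSeries_zmod_three
  refine eq_of_cube_add_sq_eq hc0 (by simp [hf0]) ?_
    (map_connNoncrossingSeries_cubic.trans hroot.symm)
  simp only [hc1, hf1, hf0, map_add, sq, coeff_one_mul]
  decide

theorem three_pow_ne_add (k i j : ℕ) : 3 ^ k ≠ 3 ^ i + 3 ^ j := by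
  have hodd : ∀ m, Odd (3 ^ m) := fun m => Odd.pow (by decide)
  exact fun h => Nat.not_even_iff_odd.2 (hodd k) (h ▸ (hodd i).add_odd (hodd j))

theorem numConnNoncrossing_modEq {n r : ℕ} (hn : 1 ≤ n)
    (h : coeff n (powSeries 3 ℤ) + coeff n (powSeries 3 ℤ ^ 2) = r) :
    numConnNoncrossing n ≡ r [MOD 3] := by
  have hmod := connNoncrossingSeries_modEq n
  rw [map_add, show powThreeSeries = powSeries 3 ℤ from rfl, h, connNoncrossingSeries, coeff_mk,
    if_pos hn] at hmod
  exact Int.natCast_modEq_iff.1 hmod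

end ModThree

theorem theorem1 :
    PowerSeriesModEq 3 connNoncrossingSeries (powThreeSeries + powThreeSeries ^ 2) ∧
    ∀ n : ℕ, 1 ≤ n →
      ((∃ k : ℕ, n = 3 ^ k ∨ n = 2 * 3 ^ k) → numConnNoncrossing n ≡ 1 [MOD 3]) ∧
      ((∃ i j : ℕ, i ≠ j ∧ n = 3 ^ i + 3 ^ j) → numConnNoncrossing n ≡ 2 [MOD 3]) ∧
      (¬ (∃ k : ℕ, n = 3 ^ k ∨ n = 2 * 3 ^ k) → ¬ (∃ i j : ℕ, i ≠ j ∧ n = 3 ^ i + 3 ^ j) →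
        numConnNoncrossing n ≡ 0 [MOD 3]) := by
  refine ⟨connNoncrossingSeries_modEq, fun n hn => ⟨?_, ?_, fun h1 h2 => ?_⟩⟩
  · rintro ⟨k, rfl | rfl⟩ <;> refine numConnNoncrossing_modEq hn ?_
    · rw [coeff_powSeries_pow, coeff_powSeries_sq_of_ne (three_pow_ne_add k)]
      rfl
    · rw [two_mul, coeff_powSeries_sq_add (by norm_num), if_pos rfl,
        coeff_powSeries_of_ne fun m => (three_pow_ne_add m k k).symm]
      rfl
  · rintro ⟨i, j, hij, rfl⟩
    refine numConnNoncrossing_modEq hn ?_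
    rw [coeff_powSeries_sq_add (by norm_num), if_neg hij,
      coeff_powSeries_of_ne fun m => (three_pow_ne_add m i j).symm]
    rfl
  · have hadd : ∀ i j, n ≠ 3 ^ i + 3 ^ j := fun i j h =>
      (eq_or_ne i j).elim (fun hij => h1 ⟨i, .inr (by rw [h, ← hij, two_mul])⟩)
        fun hij => h2 ⟨i, j, hij, h⟩
    refine numConnNoncrossing_modEq hn ?_
    rw [coeff_powSeries_of_ne fun k hk => h1 ⟨k, .inl hk⟩, coeff_powSeries_sq_of_ne hadd]
    rfl
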